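/- Let $R$ be a finite or countable commutative ring with unit. Let $p$ be the smallest prime number that is not invertible in $R$, with $p=\infty$ if every prime is invertible in $R$ (for instance if $R\supseteq\mathbf{Q}$). Let $c$ be an integer with $1\le c\le p-1$. Let $R[x]_{\le c}$ be the additive group of polynomials of degree at most $c$ over $R$, and let $\Gamma_{c,R}=R[x]_{\le c}\rtimes R$, where $r\in R$ acts by $y(r)\colon P(x)\mapsto P(x+r)$. Put $X_0(R)=\{r x^c : r\in R\}$ and $Y(R)=\{y(r) : r\in R\}$, viewed as subgroups of $\Gamma_{c,R}$. For closed subspaces $V_1,V_2$ of a complex Hilbert space $V$ with $V_1\cap V_2=\{0\}$, let $\sphericalangle(V_1,V_2)\in[0,\pi/2]$ be the angle whose cosine is $\sup\{|\langle v_1,v_2\rangle| : v_i\in V_i,\ \|v_i\|=1\}$ if both subspaces are non-zero, and $\pi/2$ otherwise. For a group $H$ generated by two subgroups $A,B$, let $\sphericalangle(H;A,B)$ be the infimum of $\sphericalangle(V^A,V^B)$ over all unitary representations of the discrete group $H$ on complex Hilbert spaces $V$ without non-zero $H$-invariant vectors, where $V^A$ and $V^B$ are the subspaces of $A$- and $B$-invariant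 vectors. Let $\varepsilon(H;A,B)=\cos\sphericalangle(H;A,B)$. Then $X_0(R)$ and $Y(R)$ generate $\Gamma_{c,R}$, so that the following quantity is defined, and $$\varepsilon\big(\Gamma_{c,R};X_0(R),Y(R)\big)\le\sqrt{c/p},$$ where $c/\infty=0$. -/

import Mathlib

open Polynomial
open scoped ENNReal

universe v u

noncomputable section

namespace RepAngle

/-! ### Unitary representations and the representation angle -/

section Angle

/-- A unitary representation of the (discrete) group `H` on the Hilbert space `V`. -/
abbrev UnitaryRep (H : Type*) [Group H] (V : Type*) [NormedAddCommGroup V]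
    [InnerProductSpace ℂ V] : Type _ :=
  H →* (V ≃ₗᵢ[ℂ] V)

/-- The subspace `V^K` of vectors fixed by the subgroup `K` of `H`. -/
def fixedSubspace {H : Type*} [Group H] {V : Type*} [NormedAddCommGroup V]
    [InnerProductSpace ℂ V] (ρ : UnitaryRep H V) (K : Subgroup H) : Submodule ℂ V where
  carrier := {v | ∀ k ∈ K, ρ k v = v}
  zero_mem' := fun k _ => map_zero (ρ k)
  add_mem' := fun {a b} ha hb k hk => by rw [map_add, ha k hk, hb k hk]
  smul_mem' := fun z v hv k hk => by rw [map_smul, hv k hk]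

/-- The representation has no non-zero vector invariant under the whole group. -/
def NoInvariantVectors {H : Type*} [Group H] {V : Type*} [NormedAddCommGroup V]
    [InnerProductSpace ℂ V] (ρ : UnitaryRep H V) : Prop :=
  ∀ v : V, (∀ h : H, ρ h v = v) → v = 0

open Classical in
/-- The angle in `[0, π/2]` formed by two subspaces: its cosine is the supremum of `|⟨v₁, v₂⟩|`
over unit vectors `v₁ ∈ V₁`, `v₂ ∈ V₂`; it is `π/2` if one of the subspaces is zero. -/
def subspaceAngle {V : Type*} [NormedAddCommGroup V] [InnerProductSpace ℂ V]
    (V₁ V₂ : Submodule ℂ V) : ℝ :=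
  if V₁ = ⊥ ∨ V₂ = ⊥ then Real.pi / 2
  else Real.arccos
    (sSup {t : ℝ | ∃ v₁ ∈ V₁, ∃ v₂ ∈ V₂, ‖v₁‖ = 1 ∧ ‖v₂‖ = 1 ∧ t = ‖inner ℂ v₁ v₂‖})

/-- The representation angle of `H` with respect to the subgroups `A` and `B`: the infimum of the
angles between `V^A` and `V^B` over all unitary representations of `H` on complex Hilbert spaces
`V` (in the universe `v`) without non-zero invariant vectors. It is used for pairs of subgroups
that generate `H`. -/
def repAngle (H : Type u) [Group H] (A B : Subgroup H) : ℝ :=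
  sInf {θ : ℝ | ∃ (V : Type v) (_ : NormedAddCommGroup V) (_ : InnerProductSpace ℂ V)
    (_ : CompleteSpace V) (ρ : UnitaryRep H V), NoInvariantVectors ρ ∧
      θ = subspaceAngle (fixedSubspace ρ A) (fixedSubspace ρ B)}

/-- The cosine of the representation angle. -/
def repCos (H : Type u) [Group H] (A B : Subgroup H) : ℝ :=
  Real.cos (repAngle.{v, u} H A B)

end Angle

/-! ### The nilpotent groups `R[x]_{≤ c} ⋊ R` -/

section Gamma

variable (c : ℕ) (R : Type*) [CommRing R]

/-- The additive automorphism `P(x) ↦ P(x + r)` of the module of polynomials of degree at most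
`c`. -/
def shift (r : R) : degreeLE R (c : WithBot ℕ) ≃+ degreeLE R (c : WithBot ℕ) where
  toFun P := ⟨(P : R[X]).comp (X + C r), by
    have h := mem_degreeLE.1 P.2
    rw [mem_degreeLE, ← taylor_apply, degree_taylor]
    exact h⟩
  invFun P := ⟨(P : R[X]).comp (X + C (-r)), by
    have h := mem_degreeLE.1 P.2
    rw [mem_degreeLE, ← taylor_apply, degree_taylor]
    exact h⟩
  left_inv P := by ext1; simp [comp_assoc]
  right_inv P := by ext1; simp [comp_assoc]
  map_add' P Q := by ext1; simp

/-- The action `r ↦ y(r)` of the additive group of `R` on polynomials of degree at most `c`. -/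
def shiftHom : Multiplicative R →* MulAut (Multiplicative (degreeLE R (c : WithBot ℕ))) where
  toFun r := AddEquiv.toMultiplicative (shift c R r.toAdd)
  map_one' := by
    ext P
    simp [shift]
  map_mul' r s := by
    refine MulEquiv.ext fun P => ?_
    refine congrArg Multiplicative.ofAdd (Subtype.ext ?_)
    change (P.toAdd : R[X]).comp (X + C (r.toAdd + s.toAdd)) =
      ((P.toAdd : R[X]).comp (X + C s.toAdd)).comp (X + C r.toAdd)
    simp [comp_assoc, add_assoc]

/-- The group `Γ_{c,R} = R[x]_{≤ c} ⋊ R`. -/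
abbrev Gamma : Type _ :=
  Multiplicative (degreeLE R (c : WithBot ℕ)) ⋊[shiftHom c R] Multiplicative R

/-- The subgroup `X_0(R) = {r x^c | r ∈ R}` of `Γ_{c,R}`. -/
def X0 : Subgroup (Gamma c R) where
  carrier := {g | ∃ r : R, g = SemidirectProduct.inl
    (Multiplicative.ofAdd ⟨C r * X ^ c, mem_degreeLE.2 (degree_C_mul_X_pow_le c r)⟩)}
  one_mem' := ⟨0, by
    rw [← map_one SemidirectProduct.inl]
    refine congrArg _ (congrArg Multiplicative.ofAdd (Subtype.ext ?_))
    simp⟩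
  mul_mem' := by
    rintro _ _ ⟨r, rfl⟩ ⟨s, rfl⟩
    refine ⟨r + s, ?_⟩
    rw [← map_mul]
    refine congrArg _ (congrArg Multiplicative.ofAdd (Subtype.ext ?_))
    simp [add_mul]
  inv_mem' := by
    rintro _ ⟨r, rfl⟩
    refine ⟨-r, ?_⟩
    rw [← map_inv]
    refine congrArg _ (congrArg Multiplicative.ofAdd (Subtype.ext ?_))
    simp

/-- The subgroup `Y(R) = {y(r) | r ∈ R}` of `Γ_{c,R}`. -/
def Y : Subgroup (Gamma c R) :=
  (SemidirectProduct.inr : Multiplicative R →* Gamma c R).range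

/-- The smallest prime number that is not invertible in `R`, and `∞` if there is none. -/
def leastNonunitPrime : ℕ∞ :=
  sInf {q : ℕ∞ | ∃ n : ℕ, n.Prime ∧ ¬ IsUnit (n : R) ∧ q = n}

end Gamma

end RepAngle

end

/-! Let N be the abelian normal subgroup of polynomials and v a unit vector fixed by Y. The
projection of v to V^N is fixed by N and Y, so it vanishes and v is orthogonal to V^N. The
conjugates of X_0 by y(0), …, y(n-1) lie in N, so the projections onto their fixed subspaces
commute. For n ≤ p a Vandermonde argument shows that any c + 1 of them generate N, hence have no
common non-zero fixed vector orthogonal to V^N.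

Joint diagonalisation then suggests that at most c of the projections can be 1 at once, so the sum
of ‖P_i v‖² is at most c (`sum_norm_sq_starProjection_le`). As v is fixed by Y, these n norms are
equal, so n‖P_0 v‖² ≤ c. Take n = p, or n arbitrarily large if p = ∞. -/

namespace RepAngle

/-! ### Commuting orthogonal projections. -/

section Projections

variable {V : Type*} [NormedAddCommGroup V] [InnerProductSpace ℂ V]

/-- Commuting orthogonal projections such that no `c + 1` of them have a common non-zero fixed
vector in the invariant subspace `U` satisfy `∑ ‖P i u‖² ≤ c ‖u‖²` on `U`. -/
theorem sum_norm_sq_starProjection_le {ι : Type*} [DecidableEq ι] (K : ι → Submodule ℂ V)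
    [∀ i, (K i).HasOrthogonalProjection]
    (hcomm : ∀ i j x, (K i).starProjection ((K j).starProjection x) =
      (K j).starProjection ((K i).starProjection x))
    (s : Finset ι) (c : ℕ) (U : Submodule ℂ V)
    (hU : ∀ i ∈ s, ∀ u ∈ U, (K i).starProjection u ∈ U)
    (h : ∀ t ⊆ s, t.card = c + 1 → ∀ u ∈ U, (∀ i ∈ t, u ∈ K i) → u = 0)
    (u : V) (hu : u ∈ U) :
    ∑ i ∈ s, ‖(K i).starProjection u‖ ^ 2 ≤ c * ‖u‖ ^ 2 := by
  induction s using Finset.induction_on generalizing c U u with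
  | empty => simp; positivity
  | insert n s hn ih =>
    set P := (K n).starProjection with hP
    have hpyth : ∀ x : V, ‖x‖ ^ 2 = ‖P x‖ ^ 2 + ‖x - P x‖ ^ 2 := by
      intro x
      have := norm_add_sq_eq_norm_sq_add_norm_sq_of_inner_eq_zero (𝕜 := ℂ) (P x) (x - P x)
        (Submodule.inner_right_of_mem_orthogonal ((K n).starProjection_apply_mem x)
          ((K n).sub_starProjection_mem_orthogonal x))
      simpa [sq] using this
    have hPn : P u ∈ U := hU n (Finset.mem_insert_self _ _) u hu
    have hb : ∑ i ∈ s, ‖(K i).starProjection (u - P u)‖ ^ 2 ≤ c * ‖u - P u‖ ^ 2 :=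
      ih c U (fun i hi => hU i (Finset.mem_insert_of_mem hi))
        (fun t ht => h t (ht.trans (Finset.subset_insert _ _))) _ (U.sub_mem hu hPn)
    -- On the range of P the projection n is already used up, so the induction hypothesis applies
    -- inside `U ⊓ K n` with c lowered by one. This pays for the term ‖P u‖².
    have ha : ∑ i ∈ s, ‖(K i).starProjection (P u)‖ ^ 2 + ‖P u‖ ^ 2 ≤ c * ‖P u‖ ^ 2 := by
      cases c with
      | zero =>
        have hz : P u = 0 := h {n} (by simp) (by simp) _ hPn
          (fun i hi => by
            rw [Finset.mem_singleton.1 hi]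
            exact (K n).starProjection_apply_mem u)
        simp [hz]
      | succ c =>
        have := ih c (U ⊓ K n)
          (fun i hi w hw => ⟨hU i (Finset.mem_insert_of_mem hi) w hw.1, by
            have hw2 : (K n).starProjection w = w := Submodule.starProjection_eq_self_iff.2 hw.2
            rw [← hw2, hcomm]
            exact (K n).starProjection_apply_mem _⟩)
          (fun t ht htc w hw hwt => h (insert n t) (Finset.insert_subset_insert _ ht)
            (by rw [Finset.card_insert_of_notMem (fun hnt => hn (ht hnt)), htc]) w hw.1
            (fun i hi => by
              rcases Finset.mem_insert.1 hi with rfl | hi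
              · exact hw.2
              · exact hwt i hi))
          (P u) ⟨hPn, (K n).starProjection_apply_mem u⟩
        push_cast
        linarith
    have hsplit : ∀ i, ‖(K i).starProjection u‖ ^ 2 =
        ‖(K i).starProjection (P u)‖ ^ 2 + ‖(K i).starProjection (u - P u)‖ ^ 2 := by
      intro i
      rw [hpyth ((K i).starProjection u), map_sub, hP, hcomm n i]
    rw [Finset.sum_insert hn, Finset.sum_congr rfl (fun i _ => hsplit i), Finset.sum_add_distrib,
      hpyth u]
    linarith

/-- A self-adjoint operator preserving L also preserves its orthogonal complement. -/
theorem starProjection_comm_of_mapsTo (K L : Submodule ℂ V) [K.HasOrthogonalProjection]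
    [L.HasOrthogonalProjection] (h : ∀ x ∈ L, K.starProjection x ∈ L) (x : V) :
    K.starProjection (L.starProjection x) = L.starProjection (K.starProjection x) := by
  symm
  refine Submodule.eq_starProjection_of_mem_of_inner_eq_zero (h _ (L.starProjection_apply_mem x))
    fun w hw => ?_
  rw [← map_sub, Submodule.inner_starProjection_left_eq_right]
  exact Submodule.inner_left_of_mem_orthogonal (h w hw) (L.sub_starProjection_mem_orthogonal x)

end Projections

/-! ### Fixed subspaces of subgroups and conjugation. -/

section Fixed

variable {H : Type*} [Group H] {V : Type*} [NormedAddCommGroup V] [InnerProductSpace ℂ V]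

theorem isClosed_fixedSubspace (ρ : UnitaryRep H V) (A : Subgroup H) :
    IsClosed (fixedSubspace ρ A : Set V) := by
  have : (fixedSubspace ρ A : Set V) = ⋂ k ∈ A, {v | ρ k v = v} := by
    ext v; simp [fixedSubspace]
  rw [this]
  exact isClosed_biInter fun k _ => isClosed_eq (ρ k).continuous continuous_id

instance [CompleteSpace V] (ρ : UnitaryRep H V) (A : Subgroup H) :
    (fixedSubspace ρ A).HasOrthogonalProjection := by
  have : CompleteSpace (fixedSubspace ρ A) := (isClosed_fixedSubspace ρ A).completeSpace_coe
  infer_instance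

theorem fixedSubspace_antitone (ρ : UnitaryRep H V) {A B : Subgroup H} (h : A ≤ B) :
    fixedSubspace ρ B ≤ fixedSubspace ρ A :=
  fun _ hv k hk => hv k (h hk)

theorem fixedSubspace_map_conj (ρ : UnitaryRep H V) (A : Subgroup H) (g : H) :
    fixedSubspace ρ (A.map (MulAut.conj g).toMonoidHom) =
      (fixedSubspace ρ A).map (ρ g).toLinearEquiv.toLinearMap := by
  ext v
  constructor
  · intro hv
    refine ⟨ρ g⁻¹ v, fun k hk => ?_, ?_⟩
    · have := hv (g * k * g⁻¹) ⟨k, hk, by simp⟩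
      conv_rhs => rw [← this]
      simp [map_mul]
    · change ρ g (ρ g⁻¹ v) = v
      simp
  · rintro ⟨w, hw, rfl⟩ _ ⟨k, hk, rfl⟩
    have := hw k hk
    simp [map_mul, this]

variable [CompleteSpace V]

/-- If g normalises A, this says that `ρ g` commutes with the projection. If g fixes x, it shows
that conjugate subgroups give projections of x of equal norm. -/
theorem starProjection_fixedSubspace_map_conj (ρ : UnitaryRep H V) (A : Subgroup H) (g : H)
    (x : V) : (fixedSubspace ρ (A.map (MulAut.conj g).toMonoidHom)).starProjection (ρ g x) =
      ρ g ((fixedSubspace ρ A).starProjection x) := by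
  refine Submodule.eq_starProjection_of_mem_of_inner_eq_zero
    (K := fixedSubspace ρ (A.map (MulAut.conj g).toMonoidHom)) ?_ fun w hw => ?_
  · rw [fixedSubspace_map_conj]
    exact ⟨_, (fixedSubspace ρ A).starProjection_apply_mem x, rfl⟩
  · rw [fixedSubspace_map_conj] at hw
    obtain ⟨w, hw, rfl⟩ := hw
    rw [← map_sub]
    exact ((ρ g).inner_map_map _ _).trans (Submodule.inner_left_of_mem_orthogonal hw
      ((fixedSubspace ρ A).sub_starProjection_mem_orthogonal x))

/-- Projections on the fixed subspaces of two elementwise commuting subgroups commute. -/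
theorem starProjection_fixedSubspace_comm (ρ : UnitaryRep H V) (A B : Subgroup H)
    (h : ∀ a ∈ A, ∀ b ∈ B, a * b = b * a) (x : V) :
    (fixedSubspace ρ A).starProjection ((fixedSubspace ρ B).starProjection x) =
      (fixedSubspace ρ B).starProjection ((fixedSubspace ρ A).starProjection x) := by
  refine starProjection_comm_of_mapsTo _ _ (fun w hw b hb => ?_) x
  have hA : A.map (MulAut.conj b).toMonoidHom = A := by
    ext a
    constructor
    · rintro ⟨a, ha, rfl⟩
      simpa [← h a ha b hb] using ha
    · intro ha
      exact ⟨a, ha, by simp [← h a ha b hb]⟩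
  have := starProjection_fixedSubspace_map_conj ρ A b w
  rwa [hA, hw b hb, eq_comm] at this

end Fixed

/-! ### Spanning polynomials by powers of linear forms. -/

section Span

variable {R : Type*} [CommRing R]

theorem isUnit_natCast_of_lt {n : ℕ} (hn : n ≠ 0) (h : (n : ℕ∞) < leastNonunitPrime R) :
    IsUnit (n : R) := by
  induction n using Nat.recOnMul with
  | zero => exact absurd rfl hn
  | one => simp
  | prime q hq =>
    by_contra hu
    exact absurd h (not_lt.2 (sInf_le ⟨q, hq, hu, rfl⟩))
  | mul a b iha ihb =>
    have ha : a ≠ 0 := left_ne_zero_of_mul hn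
    have hb : b ≠ 0 := right_ne_zero_of_mul hn
    rw [Nat.cast_mul]
    refine (iha ha (lt_of_le_of_lt ?_ h)).mul (ihb hb (lt_of_le_of_lt ?_ h))
    · exact_mod_cast Nat.le_mul_of_pos_right a (Nat.pos_of_ne_zero hb)
    · exact_mod_cast Nat.le_mul_of_pos_left b (Nat.pos_of_ne_zero ha)

/-- If `r 0, …, r c` have invertible differences and the binomial coefficients `c.choose j` are
invertible, then the powers `(X + r i) ^ c` span the polynomials of degree at most `c`. -/
theorem degreeLE_le_span_X_add_C_pow (c : ℕ) (r : Fin (c + 1) → R)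
    (hr : ∀ i j, i < j → IsUnit (r j - r i)) (hc : ∀ j ≤ c, IsUnit (c.choose j : R)) :
    degreeLE R (c : WithBot ℕ) ≤ Submodule.span R (Set.range fun i => (X + C (r i)) ^ c) := by
  classical
  set W := Submodule.span R (Set.range fun i => (X + C (r i)) ^ c)
  have hdet : IsUnit (Matrix.vandermonde r).det := by
    rw [Matrix.det_vandermonde]
    refine IsUnit.prod_iff.2 fun i _ => IsUnit.prod_iff.2 fun j hj => hr i j (by simpa using hj)
  -- Absorbing the binomial coefficients into b makes the matrix of the expansion exactly
  -- Vandermonde.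
  set b : Fin (c + 1) → R[X] := fun j => (c.choose j : R) • X ^ (c - j)
  have hexp : ∀ i, (X + C (r i)) ^ c = ∑ j, Matrix.vandermonde r i j • b j := by
    intro i
    rw [add_comm, add_pow, Finset.sum_range]
    refine Finset.sum_congr rfl fun j _ => ?_
    simp only [b, Matrix.vandermonde_apply, smul_eq_C_mul, map_pow, map_natCast]
    ring
  have hb : ∀ j, b j = ∑ i, (Matrix.vandermonde r)⁻¹ j i • (X + C (r i)) ^ c := by
    intro j
    simp_rw [hexp, Finset.smul_sum, smul_smul]
    rw [Finset.sum_comm]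
    simp_rw [← Finset.sum_smul, ← Matrix.mul_apply, Matrix.nonsing_inv_mul _ hdet,
      Matrix.one_apply, ite_smul, one_smul, zero_smul]
    simp
  have hbW : ∀ j, b j ∈ W := by
    intro j
    rw [hb]
    exact Submodule.sum_mem _ fun i _ => W.smul_mem _ (Submodule.subset_span ⟨i, rfl⟩)
  rw [degreeLE_eq_span_X_pow, Submodule.span_le]
  intro P hP
  simp only [Finset.coe_image, Finset.coe_range, Set.mem_image, Set.mem_Iio] at hP
  obtain ⟨k, hk, rfl⟩ := hP
  have h := hbW ⟨c - k, by omega⟩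
  obtain ⟨e, he⟩ := hc (c - k) (by omega)
  have := W.smul_mem (↑e⁻¹ : R) h
  simp only [b, ← he, smul_smul, Units.inv_mul, one_smul] at this
  rwa [show c - (c - k) = k by omega] at this

variable {c : ℕ}

/-- Differences of elements of t are positive integers below n, and the binomial coefficients divide
c!, a product of integers at most c. All of these are invertible. -/
theorem degreeLE_le_span_X_add_natCast_pow {n : ℕ} (hn : (n : ℕ∞) ≤ leastNonunitPrime R)
    (hcn : (c : ℕ∞) < leastNonunitPrime R)
    (t : Finset ℕ) (ht : t ⊆ Finset.range n) (htc : t.card = c + 1) :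
    degreeLE R (c : WithBot ℕ) ≤
      Submodule.span R ((fun i : ℕ => (X + C (i : R)) ^ c) '' (t : Set ℕ)) := by
  set f := t.orderEmbOfFin htc
  refine (degreeLE_le_span_X_add_C_pow c (fun i => ((f i : ℕ) : R)) ?_ ?_).trans
    (Submodule.span_mono ?_)
  · intro i j hij
    have hlt : f i < f j := f.strictMono hij
    rw [← Nat.cast_sub hlt.le]
    have : f j < n := Finset.mem_range.1 (ht (t.orderEmbOfFin_mem htc j))
    refine isUnit_natCast_of_lt (by omega) (lt_of_lt_of_le ?_ hn)
    exact_mod_cast (by omega : f j - f i < n)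
  · intro j hj
    have hfac : IsUnit ((c.factorial : ℕ) : R) := by
      rw [← Finset.prod_range_add_one_eq_factorial, Nat.cast_prod]
      refine IsUnit.prod_iff.2 fun i hi => isUnit_natCast_of_lt (by omega) (lt_of_le_of_lt ?_ hcn)
      exact_mod_cast Finset.mem_range.1 hi
    refine isUnit_of_dvd_unit (Nat.cast_dvd_cast ?_) hfac
    exact ⟨j.factorial * (c - j).factorial, by
      rw [← mul_assoc, Nat.choose_mul_factorial_mul_factorial hj]⟩
  · rintro _ ⟨i, rfl⟩
    exact ⟨f i, t.orderEmbOfFin_mem htc i, rfl⟩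

end Span

/-! ### Generation of the polynomial subgroup and of Γ. -/

section Generation

variable {R : Type*} [CommRing R] {c : ℕ}

/-- The normal subgroup `R[x]_{≤ c}` of `Γ_{c,R}`. -/
noncomputable def polySubgroup (c : ℕ) (R : Type*) [CommRing R] : Subgroup (Gamma c R) :=
  (SemidirectProduct.inl : Multiplicative (degreeLE R (c : WithBot ℕ)) →* Gamma c R).range

/-- The conjugate of `X_0(R)` by `y(r)`. -/
noncomputable def conjX0 (c : ℕ) (r : R) : Subgroup (Gamma c R) :=
  (X0 c R).map (MulAut.conj (SemidirectProduct.inr (Multiplicative.ofAdd r))).toMonoidHom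

theorem mul_comm_of_mem_polySubgroup {g h : Gamma c R} (hg : g ∈ polySubgroup c R)
    (hh : h ∈ polySubgroup c R) : g * h = h * g := by
  obtain ⟨a, rfl⟩ := hg
  obtain ⟨b, rfl⟩ := hh
  rw [← map_mul, ← map_mul, mul_comm]

theorem conj_mem_polySubgroup (k : Gamma c R) {g : Gamma c R} (hg : g ∈ polySubgroup c R) :
    k * g * k⁻¹ ∈ polySubgroup c R := by
  rw [polySubgroup, SemidirectProduct.range_inl_eq_ker_rightHom] at hg ⊢
  exact (MonoidHom.normal_ker _).conj_mem g hg k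

theorem conjX0_le_polySubgroup (r : R) : conjX0 c r ≤ polySubgroup c R := by
  rintro _ ⟨_, ⟨s, rfl⟩, rfl⟩
  exact conj_mem_polySubgroup _ ⟨_, rfl⟩

theorem inl_mem_conjX0 (r s : R) (P : degreeLE R (c : WithBot ℕ))
    (hP : (P : R[X]) = s • (X + C r) ^ c) :
    (SemidirectProduct.inl (Multiplicative.ofAdd P) : Gamma c R) ∈ conjX0 c r := by
  refine ⟨_, ⟨s, rfl⟩, ?_⟩
  rw [MulEquiv.toMonoidHom_eq_coe, MonoidHom.coe_coe, MulAut.conj_apply, ← map_inv,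
    ← SemidirectProduct.inl_aut]
  refine congrArg _ (congrArg Multiplicative.ofAdd (Subtype.ext ?_))
  change (C s * X ^ c : R[X]).comp (X + C r) = P
  simp [hP, smul_eq_C_mul]

/-- Any `c + 1` of the conjugates of `X_0(R)` by `y(0), …, y(n - 1)` generate `R[x]_{≤ c}`. -/
theorem polySubgroup_le_of_conjX0_le {n : ℕ} (hn : (n : ℕ∞) ≤ leastNonunitPrime R)
    (hcn : (c : ℕ∞) < leastNonunitPrime R)
    (t : Finset ℕ) (ht : t ⊆ Finset.range n) (htc : t.card = c + 1)
    (G : Subgroup (Gamma c R)) (hG : ∀ i ∈ t, conjX0 c (i : R) ≤ G) : polySubgroup c R ≤ G := by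
  rintro _ ⟨P, rfl⟩
  obtain ⟨P, hP⟩ := P
  have hdeg : ∀ i : ℕ, ∀ s : R, s • (X + C (i : R)) ^ c ∈ degreeLE R (c : WithBot ℕ) := by
    intro i s
    refine Submodule.smul_mem _ _ (mem_degreeLE.2 ((degree_pow_le _ _).trans ?_))
    calc c • (X + C (i : R)).degree ≤ c • (1 : WithBot ℕ) :=
          nsmul_le_nsmul_right (degree_add_le_of_degree_le degree_X_le
            (degree_C_le.trans zero_le_one)) c
      _ = c := by simp
  -- G is closed under addition but not a priori under scalars. The induction therefore needs
  -- scalars only on the generators, where s(x + i)^c lies in the conjugate of X_0.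
  have key : ∀ Q ∈ Submodule.span R ((fun i : ℕ => (X + C (i : R)) ^ c) '' (t : Set ℕ)),
      ∃ hQ : Q ∈ degreeLE R (c : WithBot ℕ),
        (SemidirectProduct.inl (Multiplicative.ofAdd ⟨Q, hQ⟩) : Gamma c R) ∈ G := by
    intro Q hQ
    induction hQ using Submodule.closure_induction with
    | zero => exact ⟨Submodule.zero_mem _, by
        convert G.one_mem
        exact map_one SemidirectProduct.inl⟩
    | add x y _ _ hx hy =>
      obtain ⟨hx, hx'⟩ := hx
      obtain ⟨hy, hy'⟩ := hy
      refine ⟨Submodule.add_mem _ hx hy, ?_⟩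
      have := G.mul_mem hx' hy'
      rwa [← map_mul] at this
    | smul_mem s x hx =>
      obtain ⟨i, hi, rfl⟩ := hx
      exact ⟨hdeg i s, hG i hi (inl_mem_conjX0 _ s _ rfl)⟩
  exact (key P (degreeLE_le_span_X_add_natCast_pow hn hcn t ht htc hP)).2

theorem X0_sup_Y (hc : ((c + 1 : ℕ) : ℕ∞) ≤ leastNonunitPrime R) : X0 c R ⊔ Y c R = ⊤ := by
  have hlt : (c : ℕ∞) < leastNonunitPrime R :=
    lt_of_lt_of_le (by exact_mod_cast Nat.lt_succ_self c) hc
  have hY : ∀ r, (SemidirectProduct.inr r : Gamma c R) ∈ X0 c R ⊔ Y c R :=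
    fun r => Subgroup.mem_sup_right ⟨r, rfl⟩
  have hN := polySubgroup_le_of_conjX0_le hc hlt (Finset.range (c + 1)) subset_rfl (by simp)
    (X0 c R ⊔ Y c R) (by
      rintro i - _ ⟨g, hg, rfl⟩
      exact mul_mem (mul_mem (hY _) (Subgroup.mem_sup_left hg)) (inv_mem (hY _)))
  refine eq_top_iff.2 fun g _ => ?_
  rw [← SemidirectProduct.inl_left_mul_inr_right g]
  exact mul_mem (hN ⟨_, rfl⟩) (hY _)

end Generation

/-! ### The bound for a vector fixed by Y. -/

section Bound

variable {R : Type*} [CommRing R] {c : ℕ} {V : Type*} [NormedAddCommGroup V]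
  [InnerProductSpace ℂ V] [CompleteSpace V]

/-- Since N is normal, the projection onto V^N commutes with the group. It sends v to a vector fixed
by both N and Y, hence to zero. -/
theorem mem_orthogonal_fixedSubspace_polySubgroup {ρ : UnitaryRep (Gamma c R) V}
    (hρ : NoInvariantVectors ρ) {v : V} (hv : v ∈ fixedSubspace ρ (Y c R)) :
    v ∈ (fixedSubspace ρ (polySubgroup c R))ᗮ := by
  set K := fixedSubspace ρ (polySubgroup c R)
  rw [← Submodule.starProjection_apply_eq_zero_iff]
  refine hρ _ fun g => ?_
  rw [← SemidirectProduct.inl_left_mul_inr_right g, map_mul]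
  set y : Gamma c R := SemidirectProduct.inr g.right
  have hN : (polySubgroup c R).map (MulAut.conj y).toMonoidHom = polySubgroup c R := by
    ext a
    constructor
    · rintro ⟨a, ha, rfl⟩
      exact conj_mem_polySubgroup y ha
    · intro ha
      exact ⟨y⁻¹ * a * y, by simpa using conj_mem_polySubgroup y⁻¹ ha, by simp [mul_assoc]⟩
  have h := starProjection_fixedSubspace_map_conj ρ (polySubgroup c R) y v
  rw [hN, hv y ⟨_, rfl⟩] at h
  change ρ _ (ρ y _) = _
  rw [← h]
  exact K.starProjection_apply_mem v _ ⟨_, rfl⟩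

theorem natCast_mul_norm_sq_le {n : ℕ} (hn : (n : ℕ∞) ≤ leastNonunitPrime R)
    (hcn : (c : ℕ∞) < leastNonunitPrime R) {ρ : UnitaryRep (Gamma c R) V}
    (hρ : NoInvariantVectors ρ) {v : V} (hv : v ∈ fixedSubspace ρ (Y c R)) :
    n * ‖(fixedSubspace ρ (X0 c R)).starProjection v‖ ^ 2 ≤ c * ‖v‖ ^ 2 := by
  have h := sum_norm_sq_starProjection_le (fun i : ℕ => fixedSubspace ρ (conjX0 c (i : R)))
    (fun i j => starProjection_fixedSubspace_comm ρ _ _ fun a ha b hb =>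
      mul_comm_of_mem_polySubgroup (conjX0_le_polySubgroup _ ha) (conjX0_le_polySubgroup _ hb))
    (Finset.range n) c (fixedSubspace ρ (polySubgroup c R))ᗮ
    -- The complement of V^N is invariant because each projection is self-adjoint and is the
    -- identity on V^N.
    (fun i _ u hu w hw => by
      rw [← Submodule.inner_starProjection_left_eq_right, Submodule.starProjection_eq_self_iff.2
        (fixedSubspace_antitone ρ (conjX0_le_polySubgroup (i : R)) hw)]
      exact hu w hw)
    (fun t ht htc u hu hut => by
      -- The stabiliser of u contains c + 1 conjugates of X_0, hence all of N.
      have hfix : u ∈ fixedSubspace ρ (polySubgroup c R) :=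
        polySubgroup_le_of_conjX0_le hn hcn t ht htc
          { carrier := {g | ρ g u = u}
            one_mem' := by simp
            mul_mem' := fun {a b} (ha : ρ a u = u) (hb : ρ b u = u) => by
              change ρ (a * b) u = u
              rw [map_mul, LinearIsometryEquiv.coe_mul, Function.comp_apply, hb, ha]
            inv_mem' := fun {a} (ha : ρ a u = u) => by
              change ρ a⁻¹ u = u
              conv_lhs => rw [← ha]
              simp } hut
      exact inner_self_eq_zero.1 (hu u hfix))
    v (mem_orthogonal_fixedSubspace_polySubgroup hρ hv)
  have heq : ∀ i : ℕ, ‖(fixedSubspace ρ (conjX0 c (i : R))).starProjection v‖ =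
      ‖(fixedSubspace ρ (X0 c R)).starProjection v‖ := by
    intro i
    have h := starProjection_fixedSubspace_map_conj ρ (X0 c R)
      (SemidirectProduct.inr (Multiplicative.ofAdd (i : R))) v
    rw [hv _ ⟨_, rfl⟩] at h
    rw [conjX0, h, LinearIsometryEquiv.norm_map]
  simpa [heq] using h

theorem norm_starProjection_le {ρ : UnitaryRep (Gamma c R) V}
    (hcn : (c : ℕ∞) < leastNonunitPrime R)
    (hρ : NoInvariantVectors ρ) {v : V} (hv : v ∈ fixedSubspace ρ (Y c R)) (hv1 : ‖v‖ = 1) :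
    ‖(fixedSubspace ρ (X0 c R)).starProjection v‖ ≤
      Real.sqrt ((c : ℝ≥0∞) / (leastNonunitPrime R : ℝ≥0∞)).toReal := by
  have key := fun (n : ℕ) (hn : (n : ℕ∞) ≤ leastNonunitPrime R) =>
    natCast_mul_norm_sq_le hn hcn hρ hv
  simp only [hv1, one_pow, mul_one] at key
  refine Real.le_sqrt_of_sq_le ?_
  generalize leastNonunitPrime R = p at *
  set a := ‖(fixedSubspace ρ (X0 c R)).starProjection v‖ ^ 2
  induction p using ENat.recTopCoe with
  | top =>
    simp only [ENat.toENNReal_top, ENNReal.div_top, ENNReal.toReal_zero]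
    by_contra! ha
    -- When p = ∞ every n is allowed, and n a ≤ c for all n forces a = 0.
    obtain ⟨n, hn⟩ := exists_nat_gt (c / a)
    rw [div_lt_iff₀ ha] at hn
    exact absurd (key n le_top) (not_le.2 hn)
  | coe p =>
    have hp : (0 : ℝ) < p := by
      have : c < p := by exact_mod_cast hcn
      exact_mod_cast (by omega : 0 < p)
    simp only [ENat.toENNReal_coe, ENNReal.toReal_div, ENNReal.toReal_natCast]
    rw [le_div_iff₀ hp, mul_comm]
    exact key p le_rfl

end Bound

/-- For v in K, ⟨v, w⟩ = ⟨v, P_K w⟩, so Cauchy–Schwarz bounds the cosine by ‖P_K w‖. -/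
theorem arccos_le_subspaceAngle {V : Type*} [NormedAddCommGroup V] [InnerProductSpace ℂ V]
    (K L : Submodule ℂ V) [K.HasOrthogonalProjection] {ε : ℝ} (hε : 0 ≤ ε)
    (h : ∀ v ∈ L, ‖v‖ = 1 → ‖K.starProjection v‖ ≤ ε) :
    Real.arccos ε ≤ subspaceAngle K L := by
  rw [subspaceAngle]
  split_ifs
  · exact Real.arccos_le_pi_div_two.2 hε
  · refine Real.arccos_le_arccos (Real.sSup_le ?_ hε)
    rintro _ ⟨v, hv, w, hw, hv1, hw1, rfl⟩
    rw [← Submodule.starProjection_eq_self_iff.2 hv, Submodule.inner_starProjection_left_eq_right]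
    calc ‖inner ℂ v (K.starProjection w)‖ ≤ ‖v‖ * ‖K.starProjection w‖ := norm_inner_le_norm _ _
      _ ≤ ε := by rw [hv1, one_mul]; exact h w hw hw1

theorem repCos_le {H : Type u} [Group H] (A B : Subgroup H) {ε : ℝ} (hε : 0 ≤ ε) (hε1 : ε ≤ 1)
    (h : ∀ (V : Type v) [NormedAddCommGroup V] [InnerProductSpace ℂ V] [CompleteSpace V]
      (ρ : UnitaryRep H V), NoInvariantVectors ρ → ∀ v ∈ fixedSubspace ρ B, ‖v‖ = 1 →
        ‖(fixedSubspace ρ A).starProjection v‖ ≤ ε) :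
    repCos.{v, u} H A B ≤ ε := by
  set S : Set ℝ := {θ : ℝ | ∃ (V : Type v) (_ : NormedAddCommGroup V) (_ : InnerProductSpace ℂ V)
    (_ : CompleteSpace V) (ρ : UnitaryRep H V), NoInvariantVectors ρ ∧
      θ = subspaceAngle (fixedSubspace ρ A) (fixedSubspace ρ B)} with hS
  have hlb : ∀ θ ∈ S, Real.arccos ε ≤ θ := by
    rintro _ ⟨V, _, _, _, ρ, hρ, rfl⟩
    exact arccos_le_subspaceAngle _ _ hε (h V ρ hρ)
  -- The zero representation makes the infimum run over a non-empty set and keeps it at most π/2,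
  -- where cosine is decreasing.
  have hmem : Real.pi / 2 ∈ S := by
    refine ⟨PUnit, inferInstance, inferInstance, inferInstance, 1, fun v _ => rfl, ?_⟩
    rw [subspaceAngle, if_pos (Or.inl (Subsingleton.elim _ _))]
  have h1 : Real.arccos ε ≤ repAngle.{v, u} H A B := le_csInf ⟨_, hmem⟩ hlb
  have h2 : repAngle.{v, u} H A B ≤ Real.pi / 2 := csInf_le ⟨_, hlb⟩ hmem
  rw [repCos, ← Real.cos_arccos (by linarith) hε1]
  exact Real.cos_le_cos_of_nonneg_of_le_pi (Real.arccos_nonneg _)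
    (h2.trans (by linarith [Real.pi_pos])) h1

end RepAngle

theorem mainTheorem10 (R : Type u) [CommRing R] [Countable R] (c : ℕ) (hc : 1 ≤ c)
    (hcp : (c : ℕ∞) ≤ RepAngle.leastNonunitPrime R - 1) :
    RepAngle.X0 c R ⊔ RepAngle.Y c R = ⊤ ∧
      RepAngle.repCos.{v, u} (RepAngle.Gamma c R) (RepAngle.X0 c R) (RepAngle.Y c R) ≤
        Real.sqrt ((c : ℝ≥0∞) / (RepAngle.leastNonunitPrime R : ℝ≥0∞)).toReal := by
  -- Subtraction is truncated, so c ≥ 1 is what turns c ≤ p - 1 into c + 1 ≤ p.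
  have hc1 : ((c + 1 : ℕ) : ℕ∞) ≤ RepAngle.leastNonunitPrime R := by
    generalize RepAngle.leastNonunitPrime R = p at hcp
    induction p using ENat.recTopCoe with
    | top => exact le_top
    | coe p =>
      have : c ≤ p - 1 := by exact_mod_cast hcp
      exact_mod_cast (by omega : c + 1 ≤ p)
  have hlt : (c : ℕ∞) < RepAngle.leastNonunitPrime R :=
    lt_of_lt_of_le (by exact_mod_cast Nat.lt_succ_self c) hc1
  refine ⟨RepAngle.X0_sup_Y hc1, RepAngle.repCos_le _ _ (Real.sqrt_nonneg _) ?_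
    fun V _ _ _ ρ hρ v hv hv1 => RepAngle.norm_starProjection_le hlt hρ hv hv1⟩
  rw [Real.sqrt_le_one]
  refine ENNReal.toReal_le_of_le_ofReal zero_le_one ?_
  rw [ENNReal.ofReal_one]
  refine ENNReal.div_le_of_le_mul ?_
  rw [one_mul]
  exact_mod_cast hlt.le
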